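/- Let $m,n\ge 0$ be integers, let $\alpha_1,\dots,\alpha_n$ be linear forms on $\mathbb R^m$, let $\lambda>0$, and let $\chi$ be a (continuous) unitary character of $\mathbb R^m$ with differential $d\chi$ at $0$. For $z,w\in\mathbb C^n$ write $zw=\sum_{k=1}^n z_kw_k$, $\bar z=(\bar z_1,\dots,\bar z_n)$, $|z|^2=z\bar z$, and for $t\in\mathbb R^m$ write $t\cdot z=(e^{i\alpha_k(t)}z_k)_k$, $t^{-1}\cdot z=(-t)\cdot z$ and $\alpha(t)z=(\alpha_k(t)z_k)_k$. Let $G=\mathbb R^m\times\mathbb C^n\times\mathbb R$ be the generalized diamond group, with multiplication $$(t,z,c)(t',z',c')=\bigl(t+t',\,z+t\cdot z',\,c+c'+\tfrac i4\bigl(z\,\overline{t\cdot z'}-(t\cdot z')\,\bar z\bigr)\bigr),$$ and let $\mathfrak g=\mathbb R^m\times\mathbb C^n\times\mathbb R$ be its Lie algebra, the tangent space at the identity. Let $d\mu_\lambda(z)=(2\pi)^{-n}\lambda^n\,dx\,dy$ $(z=x+iy)$, and let $\mathcal F_\lambda$ be the Fock space of all holomorphic functions $f$ on $\mathbb C^n$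 with $\int_{\mathbb C^n}|f(z)|^2e^{-\lambda|z|^2/2}\,d\mu_\lambda(z)<\infty$, with inner product $\langle f,g\rangle=\int f\bar g\,e^{-\lambda|z|^2/2}\,d\mu_\lambda$ and coherent states $e_z(w)=\exp(\lambda\bar zw/2)$. Let $\pi$ be the representation of $G$ on $\mathcal F_\lambda$ given by $$(\pi(t,z_0,c_0)f)(z)=\chi(t)\exp\bigl(i\lambda c_0+\tfrac\lambda2\bar z_0z-\tfrac\lambda4|z_0|^2\bigr)f\bigl(t^{-1}\cdot(z-z_0)\bigr),$$ and for $X\in\mathfrak g$ let $d\pi(X)f=\frac{d}{ds}\big|_{s=0}\pi(\exp(sX))f$, defined for those $f\in\mathcal F_\lambda$ for which this derivative exists in norm. For an operator $A$ on $\mathcal F_\lambda$ whose domain contains all coherent states let $k_A(z,w)=\langle Ae_w,e_z\rangle$, and define its Berezin symbol and its complex Weyl symbol by $$S(A)(z)=\frac{\langle Ae_z,e_z\rangle}{\langle e_z,e_z\rangle},\qquad W_0(A)(z)=2^n\int_{\mathbb C^n}k_A(z+w,z-w)\exp\bigl(\tfrac\lambda2(-z\bar z-w\bar w+z\bar w-\bar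 zw)\bigr)\,d\mu_\lambda(w).$$ Let $X=(t,u,c)\in\mathfrak g$. Then $\chi$ is differentiable at $0$, all coherent states lie in the domain of $d\pi(X)$, for every $z\in\mathbb C^n$ the integral defining $W_0(d\pi(X))(z)$ converges absolutely, and $$S(d\pi(X))(z)=d\chi(t)+i\lambda c+\tfrac\lambda2(\bar uz-\bar zu)-\tfrac{\lambda}{2}i\,\bar z(\alpha(t)z),$$ $$W_0(d\pi(X))(z)=d\chi(t)+i\lambda c+\tfrac\lambda2(\bar uz-\bar zu)+\tfrac i2\sum_{k=1}^n\alpha_k(t)\bigl(1-\lambda|z_k|^2\bigr).$$ -/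

import Mathlib

noncomputable section

open MeasureTheory Complex ComplexConjugate

namespace GenDiamond

/-! ### The generalized diamond group -/

/-- The bilinear product `z w = ∑ k, z_k w_k` on `ℂⁿ`. -/
def bil {n : ℕ} (z w : Fin n → ℂ) : ℂ := ∑ k, z k * w k

/-- Coordinatewise conjugation on `ℂⁿ`. -/
def cconj {n : ℕ} (z : Fin n → ℂ) : Fin n → ℂ := fun k => conj (z k)

/-- The squared Euclidean length `|z|² = ∑ k, |z_k|²` on `ℂⁿ`. -/
def nsq {n : ℕ} (z : Fin n → ℂ) : ℝ := ∑ k, ‖z k‖ ^ 2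

/-- `ω((z, z̄), (w, w̄)) = (i/2) (z w̄ - w z̄)`; this complex number is real. -/
def omega {n : ℕ} (z w : Fin n → ℂ) : ℝ := (I / 2 * (bil z (cconj w) - bil w (cconj z))).re

/-- The action `t · z = (e^{i α_k(t)} z_k)_k` of `ℝᵐ` on `ℂⁿ`. -/
def act {m n : ℕ} (α : Fin n → Module.Dual ℝ (Fin m → ℝ)) (t : Fin m → ℝ) (z : Fin n → ℂ) :
    Fin n → ℂ := fun k => cexp (I * (α k t : ℝ)) * z k

/-- The generalized diamond group `ℝᵐ ⋉ Hₙ` attached to the linear forms `α₁, …, αₙ`. -/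
@[ext]
structure Diamond {m n : ℕ} (α : Fin n → Module.Dual ℝ (Fin m → ℝ)) where
  t : Fin m → ℝ
  z : Fin n → ℂ
  c : ℝ

section Group

variable {m n : ℕ} {α : Fin n → Module.Dual ℝ (Fin m → ℝ)}

theorem act_add (t s : Fin m → ℝ) (z : Fin n → ℂ) : act α (t + s) z = act α t (act α s z) := by
  funext k
  simp only [act, map_add, ofReal_add, mul_add, Complex.exp_add, mul_assoc]

theorem act_zero (z : Fin n → ℂ) : act α 0 z = z := by
  funext k; simp [act]

theorem omega_eq (z w : Fin n → ℂ) :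
    omega z w = ∑ k, ((z k).re * (w k).im - (z k).im * (w k).re) := by
  simp only [omega, bil, cconj, ← Finset.sum_sub_distrib, Finset.mul_sum, re_sum]
  refine Finset.sum_congr rfl fun k _ => ?_
  simp [Complex.mul_re, Complex.mul_im]
  ring

theorem omega_add_left (z z' w : Fin n → ℂ) : omega (z + z') w = omega z w + omega z' w := by
  simp only [omega_eq, ← Finset.sum_add_distrib]
  refine Finset.sum_congr rfl fun k _ => ?_
  simp; ring

theorem omega_add_right (z w w' : Fin n → ℂ) : omega z (w + w') = omega z w + omega z w' := by
  simp only [omega_eq, ← Finset.sum_add_distrib]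
  refine Finset.sum_congr rfl fun k _ => ?_
  simp; ring

theorem normSq_phase (x : ℝ) : Complex.normSq (cexp (I * (x : ℝ))) = 1 := by
  rw [Complex.normSq_eq_norm_sq, mul_comm, Complex.norm_exp_ofReal_mul_I]; norm_num

theorem omega_act (t : Fin m → ℝ) (z w : Fin n → ℂ) :
    omega (act α t z) (act α t w) = omega z w := by
  simp only [omega_eq, act]
  refine Finset.sum_congr rfl fun k _ => ?_
  have h := normSq_phase (α k t)
  rw [Complex.normSq_apply] at h
  simp only [Complex.mul_re, Complex.mul_im]
  linear_combination ((z k).re * (w k).im - (z k).im * (w k).re) * h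

theorem omega_neg_self (z : Fin n → ℂ) : omega (-z) z = 0 := by
  rw [omega_eq]
  refine Finset.sum_eq_zero fun k _ => ?_
  simp; ring

/-- `(t,z,c)(t',z',c') = (t + t', z + t·z', c + c' + ½ ω((z,z̄),(t·z', conj (t·z'))))`. -/
instance : Mul (Diamond α) :=
  ⟨fun g h => ⟨g.t + h.t, g.z + act α g.t h.z, g.c + h.c + 1 / 2 * omega g.z (act α g.t h.z)⟩⟩

instance : One (Diamond α) := ⟨⟨0, 0, 0⟩⟩

instance : Inv (Diamond α) := ⟨fun g => ⟨-g.t, -act α (-g.t) g.z, -g.c⟩⟩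

theorem mul_def (g h : Diamond α) : g * h =
    ⟨g.t + h.t, g.z + act α g.t h.z, g.c + h.c + 1 / 2 * omega g.z (act α g.t h.z)⟩ := rfl

theorem one_def : (1 : Diamond α) = ⟨0, 0, 0⟩ := rfl

theorem inv_def (g : Diamond α) : g⁻¹ = ⟨-g.t, -act α (-g.t) g.z, -g.c⟩ := rfl

theorem act_vadd (t : Fin m → ℝ) (z w : Fin n → ℂ) :
    act α t (z + w) = act α t z + act α t w := by
  funext k; simp [act, mul_add]

theorem act_vzero (t : Fin m → ℝ) : act α t (0 : Fin n → ℂ) = 0 := by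
  funext k; simp [act]

theorem omega_zero_left (w : Fin n → ℂ) : omega 0 w = 0 := by simp [omega_eq]

theorem omega_zero_right (w : Fin n → ℂ) : omega w 0 = 0 := by simp [omega_eq]

instance : Group (Diamond α) :=
  Group.ofLeftAxioms
    (by
      intro a b c
      simp only [mul_def, act_add, act_vadd, omega_add_left, omega_add_right, omega_act,
        Diamond.mk.injEq]
      refine ⟨add_assoc _ _ _, add_assoc _ _ _, by ring⟩)
    (by
      intro a
      simp only [mul_def, one_def, act_zero, omega_zero_left, zero_add]
      ext <;> simp)
    (by
      intro a
      simp only [mul_def, inv_def, one_def, omega_neg_self, Diamond.mk.injEq]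
      refine ⟨by simp, by simp, by simp⟩)

end Group

/-- The Lie algebra `𝔤` of the generalized diamond group: the tangent space at the identity,
with elements `(t, u, c)`. -/
abbrev LieAlg (m n : ℕ) : Type := (Fin m → ℝ) × (Fin n → ℂ) × ℝ

/-- The one-parameter subgroup `s ↦ exp (s X)` of the generalized diamond group.
`expCurve_add` and `hasDerivAt_expCurve` say that it is the one with initial velocity `X`.
(In the last component a term with `α_k(t) = 0` is `0`, as it should be.) -/
def expCurve {m n : ℕ} (α : Fin n → Module.Dual ℝ (Fin m → ℝ)) (X : LieAlg m n) (s : ℝ) :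
    Diamond α where
  t := s • X.1
  z := fun k => if α k X.1 = 0 then s * X.2.1 k else
    (cexp (I * ((α k X.1 * s : ℝ) : ℂ)) - 1) / (I * (α k X.1 : ℝ)) * X.2.1 k
  c := s * X.2.2 + 1 / 2 * ∑ k, ‖X.2.1 k‖ ^ 2 *
    ((α k X.1 * s - Real.sin (α k X.1 * s)) / (α k X.1) ^ 2)

section Exp

variable {m n : ℕ} (α : Fin n → Module.Dual ℝ (Fin m → ℝ)) (X : LieAlg m n)

theorem expCurve_add (s r : ℝ) : expCurve α X (s + r) = expCurve α X s * expCurve α X r := by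
  rw [mul_def]
  simp only [expCurve, Diamond.mk.injEq]
  refine ⟨add_smul _ _ _, ?_, ?_⟩
  · funext k
    simp only [Pi.add_apply, act, map_smul, smul_eq_mul]
    by_cases h : α k X.1 = 0
    · simp [h]; ring
    · have h' : ((α k X.1 : ℝ) : ℂ) ≠ 0 := by exact_mod_cast h
      have e : I * ((α k X.1 * (s + r) : ℝ) : ℂ) =
          I * ((s * α k X.1 : ℝ) : ℂ) + I * ((α k X.1 * r : ℝ) : ℂ) := by push_cast; ring
      have e' : I * ((α k X.1 * s : ℝ) : ℂ) = I * ((s * α k X.1 : ℝ) : ℂ) := by push_cast; ring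
      simp only [h, if_false, e, e', Complex.exp_add]
      field_simp
      ring
  · rw [omega_eq]
    have key : ∀ k, ‖X.2.1 k‖ ^ 2 *
        ((α k X.1 * (s + r) - Real.sin (α k X.1 * (s + r))) / (α k X.1) ^ 2) =
        ‖X.2.1 k‖ ^ 2 * ((α k X.1 * s - Real.sin (α k X.1 * s)) / (α k X.1) ^ 2) +
        ‖X.2.1 k‖ ^ 2 * ((α k X.1 * r - Real.sin (α k X.1 * r)) / (α k X.1) ^ 2) +
        (((expCurve α X s).z k).re * (act α (s • X.1) (expCurve α X r).z k).im -
          ((expCurve α X s).z k).im * (act α (s • X.1) (expCurve α X r).z k).re) := by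
      intro k
      simp only [expCurve, act, map_smul, smul_eq_mul]
      by_cases h : α k X.1 = 0
      · simp [h]; ring
      · have h' : ((α k X.1 : ℝ) : ℂ) ≠ 0 := by exact_mod_cast h
        have e : ∀ x : ℝ, cexp (I * (x : ℂ)) = Real.cos x + Real.sin x * I := by
          intro x; rw [mul_comm, Complex.exp_mul_I]; simp
        have d : ∀ c s : ℝ, ((c : ℂ) + s * I - 1) / (I * (α k X.1 : ℝ)) =
            ((s / α k X.1 : ℝ) : ℂ) + ((1 - c) / α k X.1 : ℝ) * I := by
          intro c s
          push_cast
          rw [div_eq_iff (mul_ne_zero I_ne_zero h')]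
          field_simp
          ring_nf
          simp
          ring
        simp only [h, if_false, e, d, mul_comm s (α k X.1), mul_add, Real.sin_add]
        rw [← Complex.normSq_eq_norm_sq, Complex.normSq_apply]
        have hp := Real.sin_sq_add_cos_sq (α k X.1 * s)
        revert hp
        generalize Real.sin (α k X.1 * s) = S
        generalize Real.cos (α k X.1 * s) = C
        generalize Real.sin (α k X.1 * r) = S'
        generalize Real.cos (α k X.1 * r) = C'
        intro hp
        simp only [mul_re, mul_im, add_re, add_im, ofReal_re, ofReal_im, I_re, I_im]
        field_simp
        linear_combination -((X.2.1 k).re ^ 2 + (X.2.1 k).im ^ 2) * S' * hp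
    rw [Finset.sum_congr rfl fun k _ => key k, Finset.sum_add_distrib, Finset.sum_add_distrib]
    simp only [expCurve]
    ring

theorem hasDerivAt_expCurve :
    HasDerivAt (fun s => ((expCurve α X s).t, (expCurve α X s).z, (expCurve α X s).c)) X 0 := by
  refine HasDerivAt.prodMk ?_ (HasDerivAt.prodMk ?_ ?_)
  · simpa [expCurve] using (hasDerivAt_id (0 : ℝ)).smul_const X.1
  · refine hasDerivAt_pi.2 fun k => ?_
    simp only [expCurve]
    by_cases h : α k X.1 = 0
    · simpa [h] using (Complex.ofRealCLM.hasDerivAt (x := (0 : ℝ))).mul_const (X.2.1 k)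
    · have h' : ((α k X.1 : ℝ) : ℂ) ≠ 0 := by exact_mod_cast h
      simp only [h, if_false]
      have h1 : HasDerivAt (fun s : ℝ => I * ((α k X.1 * s : ℝ) : ℂ)) (I * (α k X.1 : ℝ)) 0 := by
        have := ((Complex.ofRealCLM.hasDerivAt (x := (0 : ℝ))).const_mul
          ((α k X.1 : ℝ) : ℂ)).const_mul I
        simpa using this
      have h2 := ((h1.cexp.sub_const 1).div_const (I * (α k X.1 : ℝ))).mul_const (X.2.1 k)
      simpa [h'] using h2
  · simp only [expCurve]
    have h1 : ∀ k ∈ (Finset.univ : Finset (Fin n)), HasDerivAt (fun s : ℝ => ‖X.2.1 k‖ ^ 2 *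
        ((α k X.1 * s - Real.sin (α k X.1 * s)) / (α k X.1) ^ 2)) 0 0 := by
      intro k _
      have h0 : HasDerivAt (fun s : ℝ => α k X.1 * s) (α k X.1) 0 := by
        simpa using (hasDerivAt_id (0 : ℝ)).const_mul (α k X.1)
      simpa using ((h0.sub h0.sin).div_const ((α k X.1) ^ 2)).const_mul (‖X.2.1 k‖ ^ 2)
    have h2 := (HasDerivAt.fun_sum h1).const_mul (1 / 2 : ℝ)
    simpa using ((hasDerivAt_id (0 : ℝ)).mul_const X.2.2).fun_add h2

end Exp

/-! ### The Fock space -/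

/-- The measure `dμ_λ(z) = (2π)⁻ⁿ λⁿ dx dy` on `ℂⁿ`. -/
def muL (n : ℕ) (lam : ℝ) : Measure (Fin n → ℂ) :=
  ENNReal.ofReal ((2 * Real.pi)⁻¹ ^ n * lam ^ n) • volume

/-- The weight `e^{-λ|z|²/2}`. -/
def gw {n : ℕ} (lam : ℝ) (z : Fin n → ℂ) : ℝ := Real.exp (-lam * nsq z / 2)

theorem continuous_nsq {n : ℕ} : Continuous (nsq : (Fin n → ℂ) → ℝ) := by
  unfold nsq; fun_prop

theorem continuous_gw {n : ℕ} (lam : ℝ) : Continuous (gw lam : (Fin n → ℂ) → ℝ) := by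
  unfold gw; have := @continuous_nsq n; fun_prop

theorem gw_pos {n : ℕ} (lam : ℝ) (z : Fin n → ℂ) : 0 < gw lam z := Real.exp_pos _

/-- The holomorphic functions `f` on `ℂⁿ` with `∫ |f(z)|² e^{-λ|z|²/2} dμ_λ(z) < ∞`. -/
def fockSubmodule (n : ℕ) (lam : ℝ) : Submodule ℂ ((Fin n → ℂ) → ℂ) where
  carrier := {f | Differentiable ℂ f ∧
    Integrable (fun z => ‖f z‖ ^ 2 * gw lam z) (muL n lam)}
  zero_mem' := ⟨differentiable_const 0, by simp⟩
  add_mem' := by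
    rintro f g ⟨hf, hfi⟩ ⟨hg, hgi⟩
    refine ⟨hf.add hg, ((hfi.const_mul 2).add (hgi.const_mul 2)).mono' ?_ ?_⟩
    · exact ((((hf.add hg).continuous.norm).pow 2).mul (continuous_gw lam)).aestronglyMeasurable
    · refine Filter.Eventually.of_forall fun z => ?_
      have h1 : ‖f z + g z‖ ^ 2 ≤ 2 * ‖f z‖ ^ 2 + 2 * ‖g z‖ ^ 2 := by
        nlinarith [norm_add_le (f z) (g z), norm_nonneg (f z + g z), norm_nonneg (f z),
          norm_nonneg (g z), sq_nonneg (‖f z‖ - ‖g z‖)]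
      have h2 := (gw_pos lam z).le
      rw [Real.norm_of_nonneg (by positivity)]
      simp only [Pi.add_apply]
      nlinarith [mul_le_mul_of_nonneg_right h1 h2]
  smul_mem' := by
    rintro a f ⟨hf, hfi⟩
    refine ⟨hf.const_smul a, ?_⟩
    refine (hfi.const_mul (‖a‖ ^ 2)).congr (Filter.Eventually.of_forall fun z => ?_)
    simp [mul_pow, mul_assoc]

/-- The Fock space `𝓕_λ`. -/
def Fock (n : ℕ) (lam : ℝ) : Type := fockSubmodule n lam

namespace Fock

variable {n : ℕ} {lam : ℝ}

instance : AddCommGroup (Fock n lam) := inferInstanceAs (AddCommGroup (fockSubmodule n lam))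

instance : Module ℂ (Fock n lam) := inferInstanceAs (Module ℂ (fockSubmodule n lam))

/-- The function on `ℂⁿ` underlying an element of the Fock space. -/
def eval (f : Fock n lam) : (Fin n → ℂ) → ℂ := Subtype.val f

instance : CoeFun (Fock n lam) (fun _ => (Fin n → ℂ) → ℂ) := ⟨eval⟩

theorem differentiable (f : Fock n lam) : Differentiable ℂ f := f.2.1

theorem integrable (f : Fock n lam) :
    Integrable (fun z => ‖f z‖ ^ 2 * gw lam z) (muL n lam) := f.2.2

@[ext]
theorem ext {f g : Fock n lam} (h : ∀ z, f z = g z) : f = g := Subtype.ext (funext h)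

theorem add_apply (f g : Fock n lam) (z : Fin n → ℂ) : (f + g) z = f z + g z := rfl

theorem smul_apply (a : ℂ) (f : Fock n lam) (z : Fin n → ℂ) : (a • f) z = a * f z := rfl

theorem zero_apply (z : Fin n → ℂ) : (0 : Fock n lam) z = 0 := rfl

theorem continuous (f : Fock n lam) : Continuous f := f.differentiable.continuous

theorem integrable_inner (f g : Fock n lam) :
    Integrable (fun z => conj (f z) * g z * gw lam z) (muL n lam) := by
  refine (f.integrable.add g.integrable).mono' ?_ (Filter.Eventually.of_forall fun z => ?_)
  · exact (((continuous_conj.comp f.continuous).mul g.continuous).mul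
      (continuous_ofReal.comp (continuous_gw lam))).aestronglyMeasurable
  · have h2 := (gw_pos lam z).le
    have h1 : ‖f z‖ * ‖g z‖ ≤ ‖f z‖ ^ 2 + ‖g z‖ ^ 2 := by
      nlinarith [sq_nonneg (‖f z‖ - ‖g z‖), sq_nonneg ‖f z‖, sq_nonneg ‖g z‖]
    simp only [norm_mul, RCLike.norm_conj, Complex.norm_real, Real.norm_of_nonneg h2, Pi.add_apply]
    nlinarith [mul_le_mul_of_nonneg_right h1 h2]

/-- The inner product `∫ conj (f z) g(z) e^{-λ|z|²/2} dμ_λ(z)`, which by the convention of Mathlib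
is linear in its second argument. -/
@[reducible]
def core (n : ℕ) (lam : ℝ) (hlam : 0 < lam) : InnerProductSpace.Core ℂ (Fock n lam) where
  inner f g := ∫ z, conj (f z) * g z * gw lam z ∂(muL n lam)
  conj_inner_symm f g := by
    rw [← integral_conj]
    congr 1; funext z
    simp [mul_comm]
  re_inner_nonneg f := by
    have : (fun z => conj (f z) * f z * (gw lam z : ℂ)) =
        fun z => ((‖f z‖ ^ 2 * gw lam z : ℝ) : ℂ) := by
      funext z; rw [Complex.conj_mul']; push_cast; ring
    rw [this, integral_complex_ofReal]
    simp only [RCLike.re_to_complex, Complex.ofReal_re]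
    exact integral_nonneg fun z => mul_nonneg (sq_nonneg _) (gw_pos lam z).le
  add_left f g h := by
    rw [← integral_add (integrable_inner f h) (integrable_inner g h)]
    congr 1; funext z
    rw [add_apply, map_add]; ring
  smul_left f g a := by
    rw [← integral_const_mul]
    congr 1; funext z
    rw [smul_apply, map_mul]; ring
  definite f hf := by
    have : (fun z => conj (f z) * f z * (gw lam z : ℂ)) =
        fun z => ((‖f z‖ ^ 2 * gw lam z : ℝ) : ℂ) := by
      funext z; rw [Complex.conj_mul']; push_cast; ring
    rw [this, integral_complex_ofReal, Complex.ofReal_eq_zero] at hf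
    have h0 := (integral_eq_zero_iff_of_nonneg
      (fun z => mul_nonneg (sq_nonneg _) (gw_pos lam z).le) f.integrable).1 hf
    have hpos : 0 < (2 * Real.pi)⁻¹ ^ n * lam ^ n := by have := Real.pi_pos; positivity
    rw [muL, Filter.EventuallyEq, Measure.ae_ennreal_smul_measure_iff
      (by simpa using hpos)] at h0
    have h1 := (Continuous.ae_eq_iff_eq (μ := (volume : Measure (Fin n → ℂ)))
      ((f.continuous.norm.pow 2).mul (continuous_gw lam)) continuous_const).1 h0
    ext z
    have h2 : ‖f z‖ ^ 2 * gw lam z = 0 := congrFun h1 z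
    simpa [(gw_pos lam z).ne', zero_apply] using h2

instance [h : Fact (0 < lam)] : NormedAddCommGroup (Fock n lam) :=
  (core n lam h.out).toNormedAddCommGroup

instance [h : Fact (0 < lam)] : InnerProductSpace ℂ (Fock n lam) :=
  InnerProductSpace.ofCore (core n lam h.out).toCore

end Fock

/-- The function `w ↦ exp (λ z̄ w / 2)`. -/
def cohFun {n : ℕ} (lam : ℝ) (z w : Fin n → ℂ) : ℂ := cexp (lam * bil (cconj z) w / 2)

theorem cohFun_mem {n : ℕ} (lam : ℝ) (hlam : 0 < lam) (z : Fin n → ℂ) :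
    cohFun lam z ∈ fockSubmodule n lam := by
  refine ⟨?_, ?_⟩
  · unfold cohFun bil; fun_prop
  · refine Integrable.smul_measure ?_ ENNReal.ofReal_ne_top
    have h1 : ∀ k : Fin n, Integrable (fun w : ℂ =>
        cexp (-((lam / 2 : ℝ) : ℂ) * ‖w‖ ^ 2 + (lam : ℂ) * (inner ℝ (z k) w : ℝ))) := fun k =>
      GaussianFourier.integrable_cexp_neg_mul_sq_norm_add (by simpa using hlam) _ _
    have h2 := (Integrable.fintype_prod (μ := fun _ => volume) h1).norm
    refine h2.congr (Filter.Eventually.of_forall fun w => ?_)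
    simp only [cohFun, gw, nsq, ← Complex.exp_sum, Complex.norm_exp, ← Real.exp_nat_mul,
      ← Real.exp_add]
    congr 1
    have e1 : ((lam : ℂ) * bil (cconj z) w / 2).re = lam / 2 * (bil (cconj z) w).re := by
      rw [show (lam : ℂ) * bil (cconj z) w / 2 = ((lam / 2 : ℝ) : ℂ) * bil (cconj z) w by
        push_cast; ring, re_ofReal_mul]
    rw [e1]
    simp only [bil, cconj, re_sum, Finset.mul_sum, Finset.sum_div, ← Finset.sum_add_distrib]
    refine Finset.sum_congr rfl fun k _ => ?_
    have e2 : -((lam / 2 : ℝ) : ℂ) * (‖w k‖ : ℂ) ^ 2 + (lam : ℂ) * (inner ℝ (z k) (w k) : ℝ) =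
        ((-(lam / 2) * ‖w k‖ ^ 2 + lam * inner ℝ (z k) (w k) : ℝ) : ℂ) := by push_cast; ring
    rw [e2, ofReal_re, Complex.inner]
    simp only [mul_re, conj_re, conj_im]
    push_cast
    ring

/-- The coherent state `e_z(w) = exp (λ z̄ w / 2)` as an element of the Fock space. -/
def coh {n : ℕ} (lam : ℝ) [h : Fact (0 < lam)] (z : Fin n → ℂ) : Fock n lam :=
  ⟨cohFun lam z, cohFun_mem lam h.out z⟩

/-! ### The generic representations -/

section Rep

variable {m n : ℕ} {α : Fin n → Module.Dual ℝ (Fin m → ℝ)} {lam : ℝ}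

/-- `(π(t,z₀,c₀)f)(z) = χ(t) exp (iλc₀ + (λ/2) z̄₀ z - (λ/4)|z₀|²) f(t⁻¹·(z - z₀))`. -/
def piFun (lam : ℝ) (χ : AddChar (Fin m → ℝ) Circle) (g : Diamond α) (f : (Fin n → ℂ) → ℂ) :
    (Fin n → ℂ) → ℂ := fun z =>
  (χ g.t : ℂ) * cexp (I * lam * g.c + lam / 2 * bil (cconj g.z) z - lam / 4 * nsq g.z) *
    f (act α (-g.t) (z - g.z))

theorem nsq_act (t : Fin m → ℝ) (z : Fin n → ℂ) : nsq (act α t z) = nsq z := by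
  simp only [nsq, act, norm_mul]
  refine Finset.sum_congr rfl fun k _ => ?_
  rw [mul_comm I, Complex.norm_exp_ofReal_mul_I, one_mul]

theorem nsq_eq (z : Fin n → ℂ) : nsq z = ∑ k, ((z k).re ^ 2 + (z k).im ^ 2) := by
  simp only [nsq, ← Complex.normSq_eq_norm_sq]
  simp only [Complex.normSq_apply, sq]

theorem re_bil_cconj (z w : Fin n → ℂ) :
    (bil (cconj z) w).re = ∑ k, ((z k).re * (w k).re + (z k).im * (w k).im) := by
  simp [bil, cconj, re_sum]

theorem measurePreserving_act (t : Fin m → ℝ) (z : Fin n → ℂ) :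
    MeasurePreserving (fun w => act α t (w - z)) (muL n lam) (muL n lam) := by
  refine MeasurePreserving.smul_measure ?_ _
  have h1 : MeasurePreserving (act α t) (volume : Measure (Fin n → ℂ)) volume := by
    refine volume_preserving_pi (f := fun k w => cexp (I * (α k t : ℝ)) * w) fun k => ?_
    have h0 : MeasurePreserving (rotation (Circle.exp (α k t))) (volume : Measure ℂ) volume :=
      (rotation (Circle.exp (α k t))).measurePreserving
    have e : ⇑(rotation (Circle.exp (α k t))) = fun w => cexp (I * (α k t : ℝ)) * w := by
      funext w
      simp [rotation_apply, Circle.coe_exp, mul_comm I]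
    rwa [e] at h0
  exact h1.comp (measurePreserving_sub_right volume z)

theorem piFun_mem (χ : AddChar (Fin m → ℝ) Circle) (g : Diamond α) {f : (Fin n → ℂ) → ℂ}
    (hf : f ∈ fockSubmodule n lam) : piFun lam χ g f ∈ fockSubmodule n lam := by
  refine ⟨?_, ?_⟩
  · have h1 : Differentiable ℂ (fun z => act α (-g.t) (z - g.z)) := by unfold act; fun_prop
    have h2 := hf.1.comp h1
    refine Differentiable.mul ?_ h2
    unfold bil; fun_prop
  · have h := ((measurePreserving_act (α := α) (lam := lam) (-g.t) g.z).integrable_comp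
      hf.2.aestronglyMeasurable).2 hf.2
    refine h.congr (Filter.Eventually.of_forall fun z => ?_)
    simp only [Function.comp_def, piFun, norm_mul, Circle.norm_coe, one_mul, mul_pow, gw, nsq_act,
      Complex.norm_exp, ← Real.exp_nat_mul]
    rw [mul_comm (Real.exp _ ), mul_assoc, ← Real.exp_add]
    congr 2
    have e1 : (I * lam * g.c + lam / 2 * bil (cconj g.z) z - lam / 4 * nsq g.z : ℂ).re =
        lam / 2 * (bil (cconj g.z) z).re - lam / 4 * nsq g.z := by
      rw [show (I * lam * g.c + lam / 2 * bil (cconj g.z) z - lam / 4 * nsq g.z : ℂ) =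
        ((lam * g.c : ℝ) : ℂ) * I + ((lam / 2 : ℝ) : ℂ) * bil (cconj g.z) z -
          ((lam / 4 * nsq g.z : ℝ) : ℂ) by push_cast; ring]
      rw [sub_re, add_re, re_ofReal_mul, re_ofReal_mul, ofReal_re, I_re]
      ring
    have e2 : nsq (z - g.z) = nsq z - 2 * (bil (cconj g.z) z).re + nsq g.z := by
      simp only [nsq_eq, re_bil_cconj, Finset.mul_sum, ← Finset.sum_sub_distrib,
        ← Finset.sum_add_distrib]
      refine Finset.sum_congr rfl fun k _ => ?_
      simp only [Pi.sub_apply, sub_re, sub_im]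
      ring
    rw [e1, e2]
    push_cast
    ring

theorem ofReal_nsq (z : Fin n → ℂ) : (nsq z : ℂ) = bil (cconj z) z := by
  simp only [nsq, bil, cconj, ofReal_sum, Complex.conj_mul', ofReal_pow]

theorem ofReal_omega (z w : Fin n → ℂ) :
    (omega z w : ℂ) = I / 2 * (bil z (cconj w) - bil w (cconj z)) := by
  refine Complex.ext (by simp [omega]) ?_
  simp [bil, cconj, im_sum, re_sum, Complex.mul_im, ← Finset.sum_sub_distrib]
  refine Finset.sum_eq_zero fun k _ => ?_
  ring

theorem bil_comm (z w : Fin n → ℂ) : bil z w = bil w z := by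
  simp only [bil, mul_comm]

theorem bil_cconj_add_left (z z' w : Fin n → ℂ) :
    bil (cconj (z + z')) w = bil (cconj z) w + bil (cconj z') w := by
  simp only [bil, cconj, Pi.add_apply, map_add, add_mul, Finset.sum_add_distrib]

theorem bil_add_right (z w w' : Fin n → ℂ) : bil z (w + w') = bil z w + bil z w' := by
  simp only [bil, Pi.add_apply, mul_add, Finset.sum_add_distrib]

theorem bil_sub_right (z w w' : Fin n → ℂ) : bil z (w - w') = bil z w - bil z w' := by
  simp only [bil, Pi.sub_apply, mul_sub, Finset.sum_sub_distrib]

theorem bil_cconj_act (t : Fin m → ℝ) (z w : Fin n → ℂ) :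
    bil (cconj z) (act α (-t) w) = bil (cconj (act α t z)) w := by
  simp only [bil, cconj, act, map_mul, map_neg, ← Complex.exp_conj, conj_I, conj_ofReal, ofReal_neg]
  refine Finset.sum_congr rfl fun k _ => ?_
  ring_nf

theorem piFun_mul (χ : AddChar (Fin m → ℝ) Circle) (g h : Diamond α) (f : (Fin n → ℂ) → ℂ) :
    piFun lam χ (g * h) f = piFun lam χ g (piFun lam χ h f) := by
  funext z
  have hz : act α (-(g.t + h.t)) (z - (g.z + act α g.t h.z)) =
      act α (-h.t) (act α (-g.t) (z - g.z) - h.z) := by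
    rw [neg_add_rev, act_add]
    congr 1
    have : z - (g.z + act α g.t h.z) = (z - g.z) + -act α g.t h.z := by abel
    rw [this, act_vadd, sub_eq_add_neg (act α (-g.t) (z - g.z))]
    congr 1
    funext k
    have := congrFun (act_add (α := α) (-g.t) g.t h.z) k
    rw [neg_add_cancel, act_zero] at this
    rw [Pi.neg_apply, this]
    simp [act]
  simp only [piFun, mul_def, hz, AddChar.map_add_eq_mul, Circle.coe_mul, bil_cconj_act]
  rw [← nsq_act (α := α) g.t h.z]
  generalize act α g.t h.z = w
  have hE : cexp (I * lam * (g.c + h.c + 1 / 2 * omega g.z w : ℝ) +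
      lam / 2 * bil (cconj (g.z + w)) z - lam / 4 * nsq (g.z + w)) =
      cexp (I * lam * g.c + lam / 2 * bil (cconj g.z) z - lam / 4 * nsq g.z) *
      cexp (I * lam * h.c + lam / 2 * bil (cconj w) (z - g.z) - lam / 4 * nsq w) := by
    rw [← Complex.exp_add]
    congr 1
    push_cast
    simp only [ofReal_omega, ofReal_nsq, bil_cconj_add_left, bil_add_right, bil_sub_right]
    rw [bil_comm g.z (cconj w), bil_comm w (cconj g.z)]
    linear_combination (lam / 4 * (bil (cconj w) g.z - bil (cconj g.z) w)) * I_mul_I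
  rw [hE]
  ring

/-- The representation `π` of the generalized diamond group on the Fock space with parameters
`λ` and `χ`. -/
def rep (lam : ℝ) (χ : AddChar (Fin m → ℝ) Circle) : Representation ℂ (Diamond α) (Fock n lam) where
  toFun g :=
    { toFun := fun f => ⟨piFun lam χ g f, piFun_mem χ g f.2⟩
      map_add' := fun f f' => Fock.ext fun z => mul_add _ _ _
      map_smul' := fun a f => Fock.ext fun z => mul_left_comm _ _ _ }
  map_one' := by
    refine LinearMap.ext fun f => Fock.ext fun z => ?_
    change piFun lam χ 1 f z = f z
    simp [piFun, one_def, act_zero, bil, cconj, nsq]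
  map_mul' g h := by
    refine LinearMap.ext fun f => Fock.ext fun z => ?_
    exact congrFun (piFun_mul χ g h f) z

/-- The (unbounded) operator `dπ(X) f = d/ds|_{s=0} π(exp (sX)) f`, with domain the set of all
`f` for which this derivative exists in the norm of the Fock space. -/
def drep (α : Fin n → Module.Dual ℝ (Fin m → ℝ)) (lam : ℝ) [Fact (0 < lam)]
    (χ : AddChar (Fin m → ℝ) Circle) (X : LieAlg m n) : Fock n lam →ₗ.[ℂ] Fock n lam where
  domain :=
    { carrier := {f | DifferentiableAt ℝ (fun s : ℝ => rep lam χ (expCurve α X s) f) 0}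
      zero_mem' := by simp
      add_mem' := by
        intro f g hf hg
        simpa using hf.fun_add hg
      smul_mem' := by
        intro a f hf
        simpa using hf.fun_const_smul a }
  toFun :=
    { toFun := fun f => deriv (fun s : ℝ => rep lam χ (expCurve α X s) (f : Fock n lam)) 0
      map_add' := by
        rintro ⟨f, hf⟩ ⟨g, hg⟩
        simpa using deriv_fun_add hf hg
      map_smul' := by
        rintro a ⟨f, hf⟩
        simpa using deriv_fun_const_smul a hf }

/-- The differential `dχ` of a character of `ℝᵐ`. -/
def dchar (χ : AddChar (Fin m → ℝ) Circle) (t : Fin m → ℝ) : ℂ :=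
  fderiv ℝ (fun s : Fin m → ℝ => (χ s : ℂ)) 0 t

end Rep

/-! ### Symbols of (possibly unbounded) operators on the Fock space -/

section Symbols

variable {n : ℕ} {lam : ℝ} [Fact (0 < lam)]

/-- The kernel `k_A(z,w) = ⟨A e_w, e_z⟩` of an operator `A` whose domain contains the coherent
states; the inner product of Mathlib is linear in the second argument. -/
def kernel (A : Fock n lam →ₗ.[ℂ] Fock n lam) (hA : ∀ w, coh lam w ∈ A.domain)
    (z w : Fin n → ℂ) : ℂ := inner ℂ (coh lam z) (A ⟨coh lam w, hA w⟩)

/-- The Berezin symbol `S(A)(z) = ⟨A e_z, e_z⟩ / ⟨e_z, e_z⟩`. -/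
def berezin (A : Fock n lam →ₗ.[ℂ] Fock n lam) (hA : ∀ w, coh lam w ∈ A.domain)
    (z : Fin n → ℂ) : ℂ := kernel A hA z z / inner ℂ (coh lam z) (coh lam z)

/-- The integrand `k_A(z+w, z-w) exp ((λ/2)(-z z̄ - w w̄ + z w̄ - z̄ w))` of the complex Weyl
symbol. -/
def weylIntegrand (A : Fock n lam →ₗ.[ℂ] Fock n lam) (hA : ∀ w, coh lam w ∈ A.domain)
    (z w : Fin n → ℂ) : ℂ :=
  kernel A hA (z + w) (z - w) * cexp (lam / 2 * (-bil z (cconj z) - bil w (cconj w) +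
    bil z (cconj w) - bil (cconj z) w))

/-- The complex Weyl symbol `W₀(A)(z) = 2ⁿ ∫ k_A(z+w, z-w) exp (…) dμ_λ(w)`. -/
def weyl0 (A : Fock n lam →ₗ.[ℂ] Fock n lam) (hA : ∀ w, coh lam w ∈ A.domain)
    (z : Fin n → ℂ) : ℂ := 2 ^ n * ∫ w, weylIntegrand A hA z w ∂(muL n lam)

end Symbols

end GenDiamond

end

noncomputable section

open MeasureTheory Complex ComplexConjugate

namespace GenDiamond

/-! ### Continuous characters are differentiable -/

/-! The group permutes the coherent states up to scalars: π(t, z₀, c₀) e_w is an explicit multiple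
of e_{z₀ + t·w} (`rep_coh`). Together with ⟨e_w, e_z⟩ = exp(λ w̄z/2), a Gaussian integral
(`inner_coh`), this makes every matrix coefficient ⟨π(exp sX) e_w, e_z⟩ an explicit scalar function
of s. Its derivative at s = 0 is the kernel of dπ(X), a polynomial in z and w̄ of degree at most one
in each, times exp(λ w̄z/2) (`kernel_drep`). On the diagonal, division by ⟨e_z, e_z⟩ leaves the
polynomial, which is S.

The analytic point is that the derivative must exist in norm. The scalar factor is differentiable
because a continuous character is (`differentiable_char`), and w ↦ e_w is real differentiable into
the Fock space (`hasFDerivAt_coh`): the pointwise Taylor remainder has exponential growth with a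
constant O(‖x - w‖²), and the Gaussian weight turns such a bound into a norm bound.

For W₀, at the arguments (z + w, z - w) the exponential of the kernel and the weight combine to
e^{-λ|w|²}. The measure 2ⁿ e^{-λ|w|²} dμ_λ(w) is a probability measure, odd terms in w integrate to
zero, and each |w_k|² has mean 1/λ. The quadratic part of the kernel polynomial contributes (iλ/2) ∑
α_k(t)|w_k|², whose mean (i/2) ∑ α_k(t) is exactly W₀ - S. -/

/-- Integrating f(s + x) = f(s) f(x) over x in [0, a] expresses f(s) ∫₀ᵃ f as a difference of values
of a primitive of f, which is differentiable; one needs an a with ∫₀ᵃ f ≠ 0. -/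
theorem differentiable_of_map_add {f : ℝ → ℂ} (hf : Continuous f) (h0 : f 0 = 1)
    (hadd : ∀ x y, f (x + y) = f x * f y) : Differentiable ℝ f := by
  have hF : ∀ u, HasDerivAt (fun u => ∫ x in (0 : ℝ)..u, f x) (f u) u := fun u =>
    intervalIntegral.integral_hasDerivAt_right (hf.intervalIntegrable _ _)
      hf.stronglyMeasurable.stronglyMeasurableAtFilter hf.continuousAt
  obtain ⟨a, ha⟩ : ∃ a, ∫ x in (0 : ℝ)..a, f x ≠ 0 := by
    -- If every such integral vanished, the primitive would be constant, against its derivative f(0)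
    -- = 1 at 0.
    by_contra! h
    have h1 := hF 0
    rw [funext h, h0] at h1
    exact one_ne_zero (h1.unique (hasDerivAt_const 0 (0 : ℂ)))
  have key : f = fun s =>
      ((∫ x in (0 : ℝ)..(s + a), f x) - ∫ x in (0 : ℝ)..s, f x) / ∫ x in (0 : ℝ)..a, f x := by
    funext s
    rw [eq_div_iff ha, ← intervalIntegral.integral_const_mul,
      intervalIntegral.integral_interval_sub_left (hf.intervalIntegrable _ _)
        (hf.intervalIntegrable _ _)]
    simp only [← hadd]
    rw [intervalIntegral.integral_comp_add_left (f := f) s, add_zero]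
  have hd : Differentiable ℝ (fun u => ∫ x in (0 : ℝ)..u, f x) := fun u =>
    (hF u).differentiableAt
  rw [key]
  exact ((hd.comp (differentiable_id.add_const a)).sub hd).div_const _

/-- χ is the product of its restrictions to the coordinate axes, which reduces the claim to one
variable. -/
theorem differentiable_char {m : ℕ} {χ : AddChar (Fin m → ℝ) Circle} (hχ : Continuous χ) :
    Differentiable ℝ (fun s : Fin m → ℝ => (χ s : ℂ)) := by
  have h1 : ∀ i : Fin m, Differentiable ℝ (fun x : ℝ => (χ (Pi.single i x) : ℂ)) := fun i =>
    differentiable_of_map_add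
      (continuous_subtype_val.comp (hχ.comp (continuous_single (A := fun _ => ℝ) i))) (by simp)
      fun x y => by rw [Pi.single_add, AddChar.map_add_eq_mul, Circle.coe_mul]
  have h2 : (fun s : Fin m → ℝ => (χ s : ℂ)) =
      fun s => ∏ i, (χ (Pi.single i (s i)) : ℂ) := by
    funext s
    have h3 : ∀ (T : Finset (Fin m)) (g : Fin m → Fin m → ℝ),
        (χ (∑ i ∈ T, g i) : ℂ) = ∏ i ∈ T, (χ (g i) : ℂ) := by
      intro T g
      induction T using Finset.cons_induction with
      | empty => simp
      | cons a T ha ih =>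
        rw [Finset.sum_cons, Finset.prod_cons, AddChar.map_add_eq_mul, Circle.coe_mul, ih]
    rw [← h3, Finset.univ_sum_single]
  rw [h2]
  have h4 : ∀ i, Differentiable ℝ (fun s : Fin m → ℝ => (χ (Pi.single i (s i)) : ℂ)) := fun i =>
    (h1 i).comp (g := fun x : ℝ => (χ (Pi.single i x) : ℂ)) (f := fun s : Fin m → ℝ => s i)
      (differentiable_apply i)
  fun_prop

theorem hasDerivAt_char_smul {m : ℕ} {χ : AddChar (Fin m → ℝ) Circle} (hχ : Continuous χ)
    (t : Fin m → ℝ) : HasDerivAt (fun s : ℝ => (χ (s • t) : ℂ)) (dchar χ t) 0 := by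
  have h1 : HasDerivAt (fun s : ℝ => s • t) t 0 := by
    simpa using (hasDerivAt_id (0 : ℝ)).smul_const t
  have h2 : HasFDerivAt (fun s : Fin m → ℝ => (χ s : ℂ))
      (fderiv ℝ (fun s : Fin m → ℝ => (χ s : ℂ)) 0) ((0 : ℝ) • t) := by
    rw [zero_smul]
    exact (differentiable_char hχ 0).hasFDerivAt
  exact h2.comp_hasDerivAt 0 h1

/-! ### Gaussian integrals -/

/-- In real coordinates the integrand splits into two one-dimensional Gaussians with linear
coefficients p + q and i(q - p); completing squares gives ((p + q)² - (q - p)²)/(4b) = pq/b. -/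
theorem integral_cexp_gaussian {b : ℝ} (hb : 0 < b) (p q : ℂ) :
    ∫ w : ℂ, cexp (p * conj w + q * w - b * ‖w‖ ^ 2) = Real.pi / b * cexp (p * q / b) := by
  have hb' : (b : ℂ) ≠ 0 := by exact_mod_cast hb.ne'
  have hre : (-(b : ℂ)).re < 0 := by simpa using hb
  rw [← Complex.volume_preserving_equiv_real_prod.symm.integral_comp
    Complex.measurableEquivRealProd.symm.measurableEmbedding]
  have e : ∀ x : ℝ × ℝ, cexp (p * conj (Complex.measurableEquivRealProd.symm x) +
      q * Complex.measurableEquivRealProd.symm x -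
        b * ‖Complex.measurableEquivRealProd.symm x‖ ^ 2) =
      cexp (-(b : ℂ) * (x.1 : ℂ) ^ 2 + (p + q) * x.1 + 0) *
      cexp (-(b : ℂ) * (x.2 : ℂ) ^ 2 + (I * (q - p)) * x.2 + 0) := by
    intro x
    rw [← Complex.exp_add, Complex.measurableEquivRealProd_symm_apply]
    congr 1
    have h1 : (⟨x.1, x.2⟩ : ℂ) = x.1 + x.2 * I := Complex.mk_eq_add_mul_I _ _
    rw [← Complex.conj_mul', h1]
    simp only [map_add, map_mul, conj_ofReal, conj_I]
    linear_combination (b * (x.2 : ℂ) ^ 2) * I_sq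
  have hne : (Real.pi / b : ℂ) ≠ 0 := div_ne_zero (by exact_mod_cast Real.pi_ne_zero) hb'
  simp only [e]
  rw [Measure.volume_eq_prod, integral_prod_mul
    (fun x : ℝ => cexp (-(b : ℂ) * (x : ℂ) ^ 2 + (p + q) * x + 0))
    (fun x : ℝ => cexp (-(b : ℂ) * (x : ℂ) ^ 2 + (I * (q - p)) * x + 0)),
    integral_cexp_quadratic hre, integral_cexp_quadratic hre, mul_mul_mul_comm, neg_neg,
    ← Complex.cpow_add _ _ hne, ← Complex.exp_add, add_halves, Complex.cpow_one]
  congr 2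
  field_simp
  linear_combination (q - p) ^ 2 * I_sq

theorem integral_norm_sq_mul_gaussian {b : ℝ} (hb : 0 < b) :
    ∫ w : ℂ, ‖w‖ ^ 2 * Real.exp (-b * ‖w‖ ^ 2) = Real.pi / b ^ 2 := by
  have h := Complex.integral_rpow_mul_exp_neg_mul_rpow (p := 2) (q := 2) (b := b)
    (by norm_num) (by norm_num) hb
  -- The general formula involves a real power of b and a Gamma value; here they are b⁻² and Γ(2) =
  -- 1.
  have e : (-(2 + 2) / 2 : ℝ) = ((-2 : ℤ) : ℝ) := by norm_num
  have e2 : ((2 + 2) / 2 : ℝ) = 1 + 1 := by norm_num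
  rw [e, e2, Real.rpow_intCast, Real.Gamma_add_one one_ne_zero, Real.Gamma_one] at h
  simp only [Real.rpow_ofNat] at h
  rw [h, zpow_neg]
  norm_num
  rfl

theorem integral_gaussian_complex {b : ℝ} (hb : 0 < b) :
    ∫ w : ℂ, Real.exp (-b * ‖w‖ ^ 2) = Real.pi / b := by
  have h := Complex.integral_exp_neg_mul_rpow (p := 2) (b := b) (by norm_num) hb
  have e : (-2 / 2 : ℝ) = ((-1 : ℤ) : ℝ) := by norm_num
  have e2 : (2 / 2 + 1 : ℝ) = 1 + 1 := by norm_num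
  rw [e, e2, Real.rpow_intCast, Real.Gamma_add_one one_ne_zero, Real.Gamma_one] at h
  simp only [Real.rpow_ofNat] at h
  rw [h, zpow_neg]
  norm_num
  rfl

/-! ### Norm estimates in the Fock space -/

section Fock

variable {n : ℕ} {lam : ℝ}

theorem integrable_exp_sum_norm {b : ℝ} (hb : 0 < b) (R : ℝ) :
    Integrable (fun w : Fin n → ℂ => Real.exp (R * ∑ k, ‖w k‖) * Real.exp (-b * nsq w)) := by
  have h1 : ∀ _ : Fin n, Integrable (fun w : ℂ =>
      Real.exp (R * ‖w‖) * Real.exp (-b * ‖w‖ ^ 2)) := by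
    intro _
    have h2 := (GaussianFourier.integrable_cexp_neg_mul_sq_norm_add (V := ℂ)
      (b := ((b / 2 : ℝ) : ℂ)) (by simpa using hb) 0 0).norm.const_mul (Real.exp (R ^ 2 / (2 * b)))
    refine h2.mono' (by fun_prop) (Filter.Eventually.of_forall fun w => ?_)
    rw [Real.norm_of_nonneg (by positivity), ← Real.exp_add, Complex.norm_exp, ← Real.exp_add,
      Real.exp_le_exp]
    have e : (-((b / 2 : ℝ) : ℂ) * (‖w‖ : ℂ) ^ 2 + 0 * ((inner ℝ (0 : ℂ) w : ℝ) : ℂ)).re =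
        -(b / 2) * ‖w‖ ^ 2 := by
      rw [zero_mul, add_zero]
      exact_mod_cast ofReal_re _
    rw [e]
    -- Half of the Gaussian decay absorbs the linear exponent, at the cost of the constant
    -- exp(R²/(2b)).
    have h3 : R ^ 2 / (2 * b) + -(b / 2) * ‖w‖ ^ 2 - (R * ‖w‖ + -b * ‖w‖ ^ 2) =
        (R - b * ‖w‖) ^ 2 / (2 * b) := by field_simp; ring
    have h4 : 0 ≤ (R - b * ‖w‖) ^ 2 / (2 * b) := by positivity
    linarith
  refine (Integrable.fintype_prod (μ := fun _ => volume) h1).congr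
    (Filter.Eventually.of_forall fun w => ?_)
  simp only [← Real.exp_add, ← Real.exp_sum, nsq, Finset.mul_sum, Finset.sum_add_distrib]

theorem integrable_sq_exp_sum_norm (hlam : 0 < lam) (M R : ℝ) :
    Integrable (fun w : Fin n → ℂ => (M * Real.exp (R * ∑ k, ‖w k‖)) ^ 2 * gw lam w)
      (muL n lam) := by
  refine Integrable.smul_measure ?_ ENNReal.ofReal_ne_top
  refine ((integrable_exp_sum_norm (half_pos hlam) (2 * R)).const_mul (M ^ 2)).congr
    (Filter.Eventually.of_forall fun w => ?_)
  simp only [mul_pow, ← Real.exp_nat_mul, gw]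
  rw [mul_assoc (M ^ 2), ← Real.exp_add, ← Real.exp_add]
  congr 2
  push_cast
  ring

theorem mem_fockSubmodule_of_le_exp (hlam : 0 < lam) {f : (Fin n → ℂ) → ℂ}
    (hf : Differentiable ℂ f) {M R : ℝ}
    (hb : ∀ z, ‖f z‖ ≤ M * Real.exp (R * ∑ k, ‖z k‖)) : f ∈ fockSubmodule n lam := by
  refine ⟨hf, (integrable_sq_exp_sum_norm hlam M R).mono' ?_
    (Filter.Eventually.of_forall fun z => ?_)⟩
  · exact ((hf.continuous.norm.pow 2).mul (continuous_gw lam)).aestronglyMeasurable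
  · have := (gw_pos lam z).le
    rw [Real.norm_of_nonneg (by positivity)]
    gcongr
    exact hb z

theorem Fock.inner_eq [Fact (0 < lam)] (f g : Fock n lam) :
    inner ℂ f g = ∫ z, conj (f z) * g z * gw lam z ∂(muL n lam) := rfl

theorem Fock.norm_sq_eq [Fact (0 < lam)] (f : Fock n lam) :
    ‖f‖ ^ 2 = ∫ z, ‖f z‖ ^ 2 * gw lam z ∂(muL n lam) := by
  have h := inner_self_eq_norm_sq_to_K (𝕜 := ℂ) f
  rw [Fock.inner_eq] at h
  have e : (fun z => conj (f z) * f z * (gw lam z : ℂ)) =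
      fun z => ((‖f z‖ ^ 2 * gw lam z : ℝ) : ℂ) := by
    funext z; rw [Complex.conj_mul']; push_cast; ring
  rw [e, integral_complex_ofReal] at h
  exact Complex.ofReal_injective (by rw [h]; norm_cast)

/-- This turns pointwise estimates into norm estimates. What matters is that C does not depend on f
or M, so a pointwise bound with small M gives a small norm. -/
theorem Fock.exists_norm_le_of_le_exp (n : ℕ) (lam : ℝ) [Fact (0 < lam)] (R : ℝ) :
    ∃ C : ℝ, 0 ≤ C ∧ ∀ (f : Fock n lam) (M : ℝ), 0 ≤ M →
      (∀ z, ‖f z‖ ≤ M * Real.exp (R * ∑ k, ‖z k‖)) → ‖f‖ ≤ C * M := by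
  have hl : 0 < lam := Fact.out
  refine ⟨√(∫ w : Fin n → ℂ, (1 * Real.exp (R * ∑ k, ‖w k‖)) ^ 2 * gw lam w ∂(muL n lam)),
    Real.sqrt_nonneg _, fun f M hM hf => ?_⟩
  refine le_of_sq_le_sq ?_ (by positivity)
  rw [mul_pow, Real.sq_sqrt (integral_nonneg fun w => mul_nonneg (sq_nonneg _) (gw_pos lam w).le),
    Fock.norm_sq_eq, ← integral_mul_const]
  refine integral_mono f.integrable ((integrable_sq_exp_sum_norm hl 1 R).mul_const _) fun z => ?_
  have h1 := (gw_pos lam z).le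
  have h2 := pow_le_pow_left₀ (norm_nonneg _) (hf z) 2
  calc ‖f z‖ ^ 2 * gw lam z ≤ (M * Real.exp (R * ∑ k, ‖z k‖)) ^ 2 * gw lam z := by gcongr
    _ = _ := by ring

/-! ### Differentiability of the coherent states -/

theorem norm_bil_cconj_le (h z : Fin n → ℂ) : ‖bil (cconj h) z‖ ≤ ‖h‖ * ∑ k, ‖z k‖ := by
  rw [bil, Finset.mul_sum]
  refine (norm_sum_le _ _).trans (Finset.sum_le_sum fun k _ => ?_)
  rw [norm_mul, cconj, RCLike.norm_conj]
  gcongr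
  exact norm_le_pi_norm h k

theorem norm_cohFun_le (hlam : 0 < lam) (w z : Fin n → ℂ) :
    ‖cohFun lam w z‖ ≤ Real.exp (lam / 2 * ‖w‖ * ∑ k, ‖z k‖) := by
  refine (Complex.norm_exp_le_exp_norm _).trans (Real.exp_le_exp.2 ?_)
  rw [norm_div, norm_mul, Complex.norm_real, Real.norm_of_nonneg hlam.le, Complex.norm_ofNat]
  have := norm_bil_cconj_le w z
  calc lam * ‖bil (cconj w) z‖ / 2 ≤ lam * (‖w‖ * ∑ k, ‖z k‖) / 2 := by gcongr
    _ = _ := by ring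

/-- The function `z ↦ (λ/2) h̄ z e_w(z)`, the derivative of `w ↦ e_w` in the direction `h`. -/
def dcohFun (lam : ℝ) (w h z : Fin n → ℂ) : ℂ := lam / 2 * bil (cconj h) z * cohFun lam w z

theorem norm_half_mul_bil_le (hlam : 0 < lam) (h z : Fin n → ℂ) :
    ‖(lam / 2 * bil (cconj h) z : ℂ)‖ ≤ lam / 2 * ‖h‖ * ∑ k, ‖z k‖ := by
  rw [norm_mul, norm_div, Complex.norm_real, Real.norm_of_nonneg hlam.le, Complex.norm_ofNat,
    mul_assoc]
  gcongr
  exact norm_bil_cconj_le h z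

theorem dcohFun_mem (hlam : 0 < lam) (w h : Fin n → ℂ) :
    dcohFun lam w h ∈ fockSubmodule n lam := by
  -- The extra 1 in the exponent pays for the linear factor, through S ≤ exp S with S = ∑ ‖z_k‖.
  refine mem_fockSubmodule_of_le_exp hlam (M := lam / 2 * ‖h‖) (R := 1 + lam / 2 * ‖w‖) ?_ ?_
  · unfold dcohFun cohFun bil; fun_prop
  · intro z
    rw [dcohFun, norm_mul, add_mul, one_mul, Real.exp_add, ← mul_assoc]
    gcongr
    · refine (norm_half_mul_bil_le hlam h z).trans ?_
      gcongr
      linarith [Real.add_one_le_exp (∑ k, ‖z k‖)]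
    · exact norm_cohFun_le hlam w z

/-- The derivative of `w ↦ e_w` at `w`. -/
def dcoh (lam : ℝ) [h : Fact (0 < lam)] (w : Fin n → ℂ) : (Fin n → ℂ) →L[ℝ] Fock n lam :=
  LinearMap.toContinuousLinearMap
    { toFun := fun v => ⟨dcohFun lam w v, dcohFun_mem h.out w v⟩
      map_add' := fun v v' => Fock.ext fun z => by
        change dcohFun lam w (v + v') z = dcohFun lam w v z + dcohFun lam w v' z
        simp only [dcohFun, bil_cconj_add_left]
        ring
      map_smul' := fun r v => by
        rw [RingHom.id_apply, ← Complex.coe_smul]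
        refine Fock.ext fun z => ?_
        change dcohFun lam w (r • v) z = r * dcohFun lam w v z
        simp only [dcohFun, bil, cconj, Pi.smul_apply, real_smul, map_mul, conj_ofReal, mul_assoc,
          ← Finset.mul_sum]
        ring }

theorem dcoh_apply [Fact (0 < lam)] (w h z : Fin n → ℂ) :
    (dcoh lam w h : Fock n lam) z = dcohFun lam w h z := rfl

theorem Fock.sub_apply (f g : Fock n lam) (z : Fin n → ℂ) : (f - g) z = f z - g z := rfl

/-- With y = (λ/2) conj(x - w) z, the remainder at z is e_w(z)(exp y - 1 - y), bounded by |e_w(z)|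
|y|² exp|y|, and |y| is at most a multiple of ‖x - w‖. The derivative is only real linear, since e_w
depends on w through its conjugate. -/
theorem hasFDerivAt_coh [Fact (0 < lam)] (w : Fin n → ℂ) :
    HasFDerivAt (coh lam) (dcoh lam w) w := by
  have hlam : 0 < lam := Fact.out
  -- The three summands of the exponent come from e_w, from S² ≤ 2 exp S, and from exp|y| with ‖x -
  -- w‖ < 1.
  obtain ⟨C, hC, hb⟩ := Fock.exists_norm_le_of_le_exp n lam (lam / 2 * ‖w‖ + 1 + lam / 2)
  refine HasFDerivAt.of_isLittleO ?_
  have h1 : (fun x => ‖x - w‖ ^ 2) =o[nhds w] fun x => x - w := by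
    have h2 : Filter.Tendsto (fun x => x - w) (nhds w) (nhds 0) := by
      have : Continuous fun x : Fin n → ℂ => x - w := by fun_prop
      simpa using this.tendsto w
    exact (Asymptotics.isLittleO_norm_pow_id one_lt_two).comp_tendsto h2
  refine Asymptotics.IsBigO.trans_isLittleO (Asymptotics.IsBigO.of_bound (C * (lam ^ 2 / 2)) ?_) h1
  -- Radius one keeps the growth rate of exp|y| independent of x, so that a single C serves.
  filter_upwards [Metric.ball_mem_nhds w one_pos] with x hx
  rw [Metric.mem_ball, dist_eq_norm] at hx
  rw [Real.norm_of_nonneg (by positivity), mul_assoc]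
  refine hb _ _ (by positivity) fun z => ?_
  rw [Fock.sub_apply, Fock.sub_apply, dcoh_apply]
  change ‖cohFun lam x z - cohFun lam w z - dcohFun lam w (x - w) z‖ ≤ _
  set y : ℂ := lam / 2 * bil (cconj (x - w)) z with hy
  set S := ∑ k, ‖z k‖ with hS
  have hS0 : 0 ≤ S := Finset.sum_nonneg fun k _ => norm_nonneg _
  have e : cohFun lam x z = cohFun lam w z * cexp y := by
    rw [cohFun, cohFun, ← Complex.exp_add, hy]
    congr 1
    have := bil_cconj_add_left (x - w) w z
    rw [sub_add_cancel] at this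
    rw [this]; ring
  have e2 : cohFun lam x z - cohFun lam w z - dcohFun lam w (x - w) z =
      cohFun lam w z * (cexp y - ∑ m ∈ Finset.range 2, y ^ m / m.factorial) := by
    rw [e, dcohFun, ← hy]
    simp [Finset.sum_range_succ]
    ring
  have hy1 : ‖y‖ ≤ lam / 2 * ‖x - w‖ * S := norm_half_mul_bil_le hlam _ z
  have hy2 : ‖y‖ ≤ lam / 2 * S := hy1.trans (by
    gcongr
    nlinarith [hx.le, norm_nonneg (x - w)])
  have hS2 : S ^ 2 ≤ 2 * Real.exp S := by
    linarith [Real.quadratic_le_exp_of_nonneg hS0]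
  rw [e2, norm_mul]
  calc ‖cohFun lam w z‖ * ‖cexp y - ∑ m ∈ Finset.range 2, y ^ m / m.factorial‖
      ≤ Real.exp (lam / 2 * ‖w‖ * S) * (‖y‖ ^ 2 * Real.exp ‖y‖) := by
        gcongr
        · exact norm_cohFun_le hlam w z
        · exact Complex.norm_exp_sub_sum_le_norm_mul_exp y 2
    _ ≤ Real.exp (lam / 2 * ‖w‖ * S) *
        ((lam / 2 * ‖x - w‖ * S) ^ 2 * Real.exp (lam / 2 * S)) := by gcongr
    _ = Real.exp (lam / 2 * ‖w‖ * S) *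
        ((lam / 2 * ‖x - w‖) ^ 2 * S ^ 2 * Real.exp (lam / 2 * S)) := by ring
    _ ≤ Real.exp (lam / 2 * ‖w‖ * S) *
        ((lam / 2 * ‖x - w‖) ^ 2 * (2 * Real.exp S) * Real.exp (lam / 2 * S)) := by gcongr
    _ = lam ^ 2 / 2 * ‖x - w‖ ^ 2 * Real.exp ((lam / 2 * ‖w‖ + 1 + lam / 2) * S) := by
        rw [add_mul, add_mul, Real.exp_add, Real.exp_add, one_mul]; ring

end Fock

/-! ### The kernel of the derived representation -/

section Kernel

variable {m n : ℕ} {α : Fin n → Module.Dual ℝ (Fin m → ℝ)} {lam : ℝ}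

theorem integral_muL {E : Type*} [NormedAddCommGroup E] [NormedSpace ℝ E] (hlam : 0 < lam)
    (f : (Fin n → ℂ) → E) :
    ∫ w, f w ∂(muL n lam) = (lam / (2 * Real.pi)) ^ n • ∫ w, f w := by
  have := Real.pi_pos
  rw [muL, integral_smul_measure, ENNReal.toReal_ofReal (by positivity), ← mul_pow,
    mul_comm _ lam, ← div_eq_mul_inv]

/-- The integrand factors over the coordinates, each factor being `integral_cexp_gaussian` with b =
λ/2, p = λz_k/2 and q = λ conj(w_k)/2; the normalization of `muL` cancels the constants (2π/λ)ⁿ. -/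
theorem inner_coh [Fact (0 < lam)] (z w : Fin n → ℂ) :
    inner ℂ (coh lam z) (coh lam w) = cexp (lam / 2 * bil (cconj w) z) := by
  have hlam : 0 < lam := Fact.out
  have hlam' : (lam : ℂ) ≠ 0 := by exact_mod_cast hlam.ne'
  have hpi : (Real.pi : ℂ) ≠ 0 := by exact_mod_cast Real.pi_ne_zero
  rw [Fock.inner_eq, integral_muL hlam]
  have e : ∀ v : Fin n → ℂ, conj (coh lam z v) * coh lam w v * gw lam v =
      ∏ k, cexp (lam / 2 * z k * conj (v k) + lam / 2 * conj (w k) * v k -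
        (lam / 2 : ℝ) * ‖v k‖ ^ 2) := by
    intro v
    change conj (cohFun lam z v) * cohFun lam w v * gw lam v = _
    rw [cohFun, cohFun, gw, ofReal_exp, ← Complex.exp_conj, ← Complex.exp_add, ← Complex.exp_add,
      ← Complex.exp_sum]
    congr 1
    simp only [bil, cconj, nsq, map_div₀, map_mul, map_sum, conj_conj, conj_ofReal, map_ofNat]
    push_cast
    simp only [Finset.mul_sum, Finset.sum_div, ← Finset.sum_add_distrib]
    refine Finset.sum_congr rfl fun k _ => ?_
    ring
  simp only [e]
  rw [integral_fintype_prod_volume_eq_prod fun k (v : ℂ) =>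
    cexp (lam / 2 * z k * conj v + lam / 2 * conj (w k) * v - (lam / 2 : ℝ) * ‖v‖ ^ 2)]
  simp only [integral_cexp_gaussian (half_pos hlam)]
  rw [Finset.prod_mul_distrib, Finset.prod_const, Finset.card_univ, Fintype.card_fin,
    ← Complex.exp_sum, real_smul, ← mul_assoc]
  push_cast
  rw [← mul_pow, show (lam / (2 * Real.pi) * (Real.pi / (lam / 2)) : ℂ) = 1 by field_simp,
    one_pow, one_mul, bil, Finset.mul_sum]
  congr 1
  refine Finset.sum_congr rfl fun k _ => ?_
  simp only [cconj]
  field_simp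

/-- The factor in `π(g) e_w = repFactor g w • e_{z₀ + t·w}` for `g = (t, z₀, c₀)`. -/
def repFactor (lam : ℝ) (χ : AddChar (Fin m → ℝ) Circle) (g : Diamond α) (w : Fin n → ℂ) : ℂ :=
  χ g.t * cexp (I * lam * g.c - lam / 4 * bil (cconj g.z) g.z -
    lam / 2 * bil (cconj (act α g.t w)) g.z)

/-- The action of t is unitary, so rotating the argument by t⁻¹ rotates the label w by t; the factor
exp(λ z̄₀z/2) then shifts the label by z₀. What is left is independent of z. -/
theorem rep_coh [Fact (0 < lam)] (χ : AddChar (Fin m → ℝ) Circle) (g : Diamond α)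
    (w : Fin n → ℂ) :
    rep lam χ g (coh lam w) = repFactor lam χ g w • coh lam (g.z + act α g.t w) := by
  refine Fock.ext fun z => ?_
  rw [Fock.smul_apply]
  change piFun lam χ g (cohFun lam w) z = repFactor lam χ g w * cohFun lam (g.z + act α g.t w) z
  rw [piFun, repFactor, cohFun, cohFun, bil_cconj_act, bil_sub_right, bil_cconj_add_left,
    ofReal_nsq, mul_assoc (χ g.t : ℂ), mul_assoc (χ g.t : ℂ), ← Complex.exp_add,
    ← Complex.exp_add]
  congr 2
  ring

/-! ### Derivatives along the one-parameter subgroup -/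

theorem hasDerivAt_bil_cconj {f g : ℝ → Fin n → ℂ} {f' g' : Fin n → ℂ} {x : ℝ}
    (hf : HasDerivAt f f' x) (hg : HasDerivAt g g' x) :
    HasDerivAt (fun s => bil (cconj (f s)) (g s))
      (bil (cconj f') (g x) + bil (cconj (f x)) g') x := by
  simp only [bil, cconj, ← Finset.sum_add_distrib]
  refine HasDerivAt.fun_sum fun k _ => ?_
  have h1 : HasDerivAt (fun s => conj (f s k)) (conj (f' k)) x :=
    Complex.conjCLE.toContinuousLinearMap.hasFDerivAt.comp_hasDerivAt x (hasDerivAt_pi.1 hf k)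
  exact h1.fun_mul (hasDerivAt_pi.1 hg k)

theorem hasDerivAt_act_smul (t : Fin m → ℝ) (w : Fin n → ℂ) :
    HasDerivAt (fun s : ℝ => act α (s • t) w) (fun k => I * α k t * w k) 0 := by
  refine hasDerivAt_pi.2 fun k => ?_
  simp only [act, map_smul, smul_eq_mul]
  have h1 : HasDerivAt (fun s : ℝ => I * ((s * α k t : ℝ) : ℂ)) (I * α k t) 0 := by
    have := ((Complex.ofRealCLM.hasDerivAt (x := (0 : ℝ))).mul_const (α k t : ℂ)).const_mul I
    simpa using this
  simpa using h1.cexp.mul_const (w k)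

theorem expCurve_zero (X : LieAlg m n) : expCurve α X 0 = 1 := by
  have h := expCurve_add α X 0 0
  rwa [add_zero, eq_comm, mul_eq_left] at h

theorem hasDerivAt_expCurve_z (X : LieAlg m n) :
    HasDerivAt (fun s => (expCurve α X s).z) X.2.1 0 :=
  (hasDerivAt_expCurve α X).snd.fst

theorem hasDerivAt_expCurve_c (X : LieAlg m n) :
    HasDerivAt (fun s => (expCurve α X s).c) X.2.2 0 :=
  (hasDerivAt_expCurve α X).snd.snd

theorem hasDerivAt_repFactor {χ : AddChar (Fin m → ℝ) Circle} (hχ : Continuous χ)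
    (X : LieAlg m n) (w : Fin n → ℂ) :
    HasDerivAt (fun s => repFactor lam χ (expCurve α X s) w)
      (dchar χ X.1 + I * lam * X.2.2 - lam / 2 * bil (cconj w) X.2.1) 0 := by
  have hz := hasDerivAt_expCurve_z (α := α) X
  have hc : HasDerivAt (fun s => ((expCurve α X s).c : ℂ)) (X.2.2 : ℂ) 0 :=
    Complex.ofRealCLM.hasFDerivAt.comp_hasDerivAt 0 (hasDerivAt_expCurve_c (α := α) X)
  have h1 := (((hc.const_mul (I * lam)).fun_sub
    ((hasDerivAt_bil_cconj hz hz).const_mul (lam / 4 : ℂ))).fun_sub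
    ((hasDerivAt_bil_cconj (hasDerivAt_act_smul (α := α) X.1 w) hz).const_mul (lam / 2 : ℂ))).cexp
  have h2 := (hasDerivAt_char_smul hχ X.1).fun_mul h1
  have h0 := expCurve_zero (α := α) X
  have hz0 : (expCurve α X 0).z = 0 := by rw [h0]; rfl
  have hc0 : (expCurve α X 0).c = 0 := by rw [h0]; rfl
  have b1 : ∀ v : Fin n → ℂ, bil v 0 = 0 := fun v => by simp [bil]
  have b2 : ∀ v : Fin n → ℂ, bil (cconj 0) v = 0 := fun v => by simp [bil, cconj]
  refine h2.congr_deriv ?_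
  -- The curve has z = 0 at s = 0, so the term quadratic in z contributes nothing to first order.
  simp only [hz0, hc0, b1, b2, zero_smul, act_zero, AddChar.map_zero_eq_one, Circle.coe_one]
  simp
  ring

theorem hasDerivAt_expCurve_orbit (X : LieAlg m n) (w : Fin n → ℂ) :
    HasDerivAt (fun s => (expCurve α X s).z + act α (expCurve α X s).t w)
      (X.2.1 + fun k => I * α k X.1 * w k) 0 :=
  (hasDerivAt_expCurve_z X).fun_add (hasDerivAt_act_smul X.1 w)

theorem expCurve_orbit_zero (X : LieAlg m n) (w : Fin n → ℂ) :
    (expCurve α X 0).z + act α (expCurve α X 0).t w = w := by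
  rw [expCurve_zero, one_def, act_zero, zero_add]

theorem differentiableAt_rep_coh [Fact (0 < lam)] {χ : AddChar (Fin m → ℝ) Circle}
    (hχ : Continuous χ) (X : LieAlg m n) (w : Fin n → ℂ) :
    DifferentiableAt ℝ (fun s : ℝ => rep lam χ (expCurve α X s) (coh lam w)) 0 := by
  simp only [rep_coh]
  refine DifferentiableAt.fun_smul (hasDerivAt_repFactor hχ X w).differentiableAt ?_
  exact (hasFDerivAt_coh _).differentiableAt.comp (0 : ℝ)
    (hasDerivAt_expCurve_orbit X w).differentiableAt

theorem kernel_drep [Fact (0 < lam)] {χ : AddChar (Fin m → ℝ) Circle} (hχ : Continuous χ)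
    (X : LieAlg m n) (hX : ∀ w, coh lam w ∈ (drep α lam χ X).domain) (z w : Fin n → ℂ) :
    kernel (drep α lam χ X) hX z w =
      (dchar χ X.1 + I * lam * X.2.2 + lam / 2 * (bil (cconj X.2.1) z - bil (cconj w) X.2.1) -
        lam / 2 * I * bil (cconj w) (fun k => (α k X.1 : ℂ) * z k)) *
      cexp (lam / 2 * bil (cconj w) z) := by
  -- Pairing with e_z is continuous, so the norm derivative passes through it. Computing the same
  -- scalar derivative from the closed form and using uniqueness gives the kernel.
  have h1 : HasDerivAt (fun s : ℝ => inner ℂ (coh lam z) (rep lam χ (expCurve α X s) (coh lam w)))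
      (kernel (drep α lam χ X) hX z w) 0 :=
    ((innerSL ℂ (coh lam z)).restrictScalars ℝ).hasFDerivAt.comp_hasDerivAt 0
      (differentiableAt_rep_coh hχ X w).hasDerivAt
  simp only [rep_coh, inner_smul_right, inner_coh] at h1
  have h2 := (hasDerivAt_repFactor (α := α) (lam := lam) hχ X w).fun_mul
    ((hasDerivAt_bil_cconj (hasDerivAt_expCurve_orbit (α := α) X w)
      (hasDerivAt_const 0 z)).const_mul (lam / 2 : ℂ)).cexp
  rw [h1.unique h2, expCurve_orbit_zero]
  have h3 : repFactor lam χ (expCurve α X 0) w = 1 := by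
    rw [expCurve_zero]
    simp [repFactor, one_def, bil, cconj]
  have h4 : bil (cconj fun k => I * α k X.1 * w k) z =
      -I * bil (cconj w) (fun k => (α k X.1 : ℂ) * z k) := by
    simp only [bil, cconj, map_mul, conj_I, conj_ofReal, Finset.mul_sum]
    exact Finset.sum_congr rfl fun k _ => by ring
  have h5 : bil (cconj w) (0 : Fin n → ℂ) = 0 := by simp [bil]
  rw [h3, bil_cconj_add_left, h4, h5]
  ring

theorem berezin_drep [Fact (0 < lam)] {χ : AddChar (Fin m → ℝ) Circle} (hχ : Continuous χ)
    (X : LieAlg m n) (hX : ∀ w, coh lam w ∈ (drep α lam χ X).domain) (z : Fin n → ℂ) :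
    berezin (drep α lam χ X) hX z =
      dchar χ X.1 + I * lam * X.2.2 + lam / 2 * (bil (cconj X.2.1) z - bil (cconj z) X.2.1) -
        lam / 2 * I * bil (cconj z) (fun k => (α k X.1 : ℂ) * z k) := by
  rw [berezin, kernel_drep hχ, inner_coh, mul_div_cancel_right₀ _ (Complex.exp_ne_zero _)]

end Kernel

/-! ### The complex Weyl symbol -/

section Weyl

variable {m n : ℕ} {α : Fin n → Module.Dual ℝ (Fin m → ℝ)} {lam : ℝ}

/-- The factor 2ⁿ arises because `muL` is normalized for the weight e^{-λ|w|²/2}, while the Weyl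
integral carries e^{-λ|w|²}. -/
theorem integral_gaussian_muL (hlam : 0 < lam) :
    2 ^ n * ∫ w, Real.exp (-lam * nsq w) ∂(muL n lam) = 1 := by
  have hpi := Real.pi_pos
  have e : ∀ w : Fin n → ℂ, Real.exp (-lam * nsq w) = ∏ k, Real.exp (-lam * ‖w k‖ ^ 2) := by
    intro w
    rw [← Real.exp_sum, nsq, Finset.mul_sum]
  simp only [integral_muL hlam, e]
  rw [integral_fintype_prod_volume_eq_prod fun _ (v : ℂ) => Real.exp (-lam * ‖v‖ ^ 2)]
  simp only [integral_gaussian_complex hlam]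
  rw [Finset.prod_const, Finset.card_univ, Fintype.card_fin, smul_eq_mul, ← mul_pow, ← mul_pow,
    show 2 * (lam / (2 * Real.pi) * (Real.pi / lam)) = 1 by field_simp, one_pow]

theorem integral_norm_sq_mul_gaussian_muL (hlam : 0 < lam) (k : Fin n) :
    2 ^ n * ∫ w, ‖w k‖ ^ 2 * Real.exp (-lam * nsq w) ∂(muL n lam) = 1 / lam := by
  have hpi := Real.pi_pos
  -- A trivial factor 1 in the coordinates j ≠ k puts the integrand in product form.
  have e : ∀ w : Fin n → ℂ, ‖w k‖ ^ 2 * Real.exp (-lam * nsq w) =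
      ∏ j, (if j = k then ‖w j‖ ^ 2 else 1) * Real.exp (-lam * ‖w j‖ ^ 2) := by
    intro w
    rw [Finset.prod_mul_distrib, Finset.prod_ite_eq', ← Real.exp_sum, nsq, Finset.mul_sum]
    simp
  have e2 : ∀ j : Fin n, ∫ v : ℂ, (if j = k then ‖v‖ ^ 2 else 1) * Real.exp (-lam * ‖v‖ ^ 2) =
      Real.pi / lam * if j = k then 1 / lam else 1 := by
    intro j
    split_ifs
    · rw [integral_norm_sq_mul_gaussian hlam]
      field_simp
    · simp only [one_mul, integral_gaussian_complex hlam, mul_one]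
  simp only [integral_muL hlam, e]
  rw [integral_fintype_prod_volume_eq_prod fun j (v : ℂ) =>
    (if j = k then ‖v‖ ^ 2 else 1) * Real.exp (-lam * ‖v‖ ^ 2)]
  simp only [e2]
  rw [Finset.prod_mul_distrib, Finset.prod_ite_eq', Finset.prod_const, Finset.card_univ,
    Fintype.card_fin, smul_eq_mul, ← mul_assoc, ← mul_assoc, ← mul_pow, ← mul_pow,
    show 2 * (lam / (2 * Real.pi)) * (Real.pi / lam) = 1 by field_simp, one_pow]
  simp

theorem integrable_mul_gaussian_muL (hlam : 0 < lam) {f : (Fin n → ℂ) → ℂ} (hf : Continuous f)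
    {M R : ℝ} (hb : ∀ w, ‖f w‖ ≤ M * Real.exp (R * ∑ k, ‖w k‖)) :
    Integrable (fun w => f w * (Real.exp (-lam * nsq w) : ℝ)) (muL n lam) := by
  refine Integrable.smul_measure ?_ ENNReal.ofReal_ne_top
  refine ((integrable_exp_sum_norm hlam R).const_mul M).mono' ?_
    (Filter.Eventually.of_forall fun w => ?_)
  · have := @continuous_nsq n
    exact (hf.mul (by fun_prop)).aestronglyMeasurable
  · rw [norm_mul, Complex.norm_real, Real.norm_of_nonneg (Real.exp_pos _).le, ← mul_assoc]
    gcongr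
    exact hb w

theorem norm_apply_le_exp (w : Fin n → ℂ) (k : Fin n) : ‖w k‖ ≤ Real.exp (∑ j, ‖w j‖) := by
  have h1 : ‖w k‖ ≤ ∑ j, ‖w j‖ :=
    Finset.single_le_sum (f := fun j => ‖w j‖) (fun j _ => norm_nonneg _) (Finset.mem_univ k)
  linarith [Real.add_one_le_exp (∑ j, ‖w j‖)]

/-- The Gaussian mean of a function of the form constant + real-linear + diagonal quadratic. -/
theorem integral_quadratic_mul_gaussian (hlam : 0 < lam) (a : ℂ) (p q b : Fin n → ℂ) :
    Integrable (fun w => (a + bil p w + bil q (cconj w) + ∑ k, b k * (‖w k‖ : ℂ) ^ 2) *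
      (Real.exp (-lam * nsq w) : ℝ)) (muL n lam) ∧
    2 ^ n * ∫ w, (a + bil p w + bil q (cconj w) + ∑ k, b k * (‖w k‖ : ℂ) ^ 2) *
      (Real.exp (-lam * nsq w) : ℝ) ∂(muL n lam) = a + ∑ k, b k / lam := by
  have i0 : Integrable (fun w : Fin n → ℂ => a * (Real.exp (-lam * nsq w) : ℝ)) (muL n lam) :=
    integrable_mul_gaussian_muL hlam (M := ‖a‖) (R := 0) continuous_const (by simp)
  have i1 : ∀ k, Integrable (fun w : Fin n → ℂ => w k * (Real.exp (-lam * nsq w) : ℝ))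
      (muL n lam) := fun k =>
    integrable_mul_gaussian_muL hlam (M := 1) (R := 1) (by fun_prop)
      (by simpa using fun w => norm_apply_le_exp w k)
  have i2 : ∀ k, Integrable (fun w : Fin n → ℂ => conj (w k) * (Real.exp (-lam * nsq w) : ℝ))
      (muL n lam) := fun k =>
    integrable_mul_gaussian_muL hlam (M := 1) (R := 1) (by fun_prop)
      (by simpa using fun w => norm_apply_le_exp w k)
  have i3 : ∀ k, Integrable (fun w : Fin n → ℂ =>
      b k * ((‖w k‖ ^ 2 * Real.exp (-lam * nsq w) : ℝ) : ℂ)) (muL n lam) := fun k => by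
    have h := integral_norm_sq_mul_gaussian_muL hlam k
    -- A non-integrable function has integral 0 by convention, so the nonzero value of the second
    -- moment already proves integrability.
    have h1 : ∫ w : Fin n → ℂ, ‖w k‖ ^ 2 * Real.exp (-lam * nsq w) ∂(muL n lam) ≠ 0 := fun h0 => by
      rw [h0, mul_zero] at h
      exact (one_div_pos.2 hlam).ne h
    exact (Integrable.of_integral_ne_zero h1).ofReal.const_mul _
  have il : Integrable (fun w => (bil p w + bil q (cconj w)) * (Real.exp (-lam * nsq w) : ℝ))
      (muL n lam) := by
    refine (integrable_finsetSum Finset.univ fun k _ =>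
      ((i1 k).const_mul (p k)).add ((i2 k).const_mul (q k))).congr
      (Filter.Eventually.of_forall fun w => ?_)
    simp only [bil, cconj, Pi.add_apply, ← Finset.sum_add_distrib, Finset.sum_mul]
    exact Finset.sum_congr rfl fun k _ => by ring
  have iq := integrable_finsetSum Finset.univ fun k _ => i3 k
  have e : (fun w => (a + bil p w + bil q (cconj w) + ∑ k, b k * (‖w k‖ : ℂ) ^ 2) *
      (Real.exp (-lam * nsq w) : ℝ)) = fun w => a * (Real.exp (-lam * nsq w) : ℝ) +
      (bil p w + bil q (cconj w)) * (Real.exp (-lam * nsq w) : ℝ) +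
      ∑ k, b k * ((‖w k‖ ^ 2 * Real.exp (-lam * nsq w) : ℝ) : ℂ) := by
    funext w
    have : ∑ k, b k * ((‖w k‖ ^ 2 * Real.exp (-lam * nsq w) : ℝ) : ℂ) =
        (∑ k, b k * (‖w k‖ : ℂ) ^ 2) * (Real.exp (-lam * nsq w) : ℝ) := by
      rw [Finset.sum_mul]
      refine Finset.sum_congr rfl fun k _ => ?_
      push_cast
      ring
    rw [this]
    ring
  -- The linear part is odd and the Gaussian even: substituting -w for w shows that the integral
  -- equals its own negative.
  have hodd : ∫ w, (bil p w + bil q (cconj w)) * (Real.exp (-lam * nsq w) : ℝ) ∂(muL n lam) =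
      0 := by
    rw [integral_muL hlam]
    have h1 := integral_neg_eq_self (fun w : Fin n → ℂ =>
      (bil p w + bil q (cconj w)) * (Real.exp (-lam * nsq w) : ℝ)) volume
    have h2 : ∀ w : Fin n → ℂ, (bil p (-w) + bil q (cconj (-w))) *
        (Real.exp (-lam * nsq (-w)) : ℝ) =
        -((bil p w + bil q (cconj w)) * (Real.exp (-lam * nsq w) : ℝ)) := by
      intro w
      simp only [bil, cconj, nsq, Pi.neg_apply, map_neg, mul_neg, norm_neg,
        Finset.sum_neg_distrib]
      ring
    simp only [h2, integral_neg] at h1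
    rw [self_eq_neg.1 h1.symm, smul_zero]
  rw [e]
  have i0l : Integrable (fun w => a * (Real.exp (-lam * nsq w) : ℝ) +
      (bil p w + bil q (cconj w)) * (Real.exp (-lam * nsq w) : ℝ)) (muL n lam) := i0.add il
  refine ⟨i0l.add iq, ?_⟩
  rw [integral_add i0l iq, integral_add i0 il, hodd, integral_const_mul,
    integral_finsetSum _ fun k _ => i3 k]
  simp only [integral_const_mul, integral_complex_ofReal]
  have g0 : (2 : ℂ) ^ n * ((∫ w, Real.exp (-lam * nsq w) ∂(muL n lam) : ℝ) : ℂ) = 1 := by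
    exact_mod_cast integral_gaussian_muL (n := n) hlam
  have g2 : ∀ k, (2 : ℂ) ^ n *
      ((∫ w, ‖w k‖ ^ 2 * Real.exp (-lam * nsq w) ∂(muL n lam) : ℝ) : ℂ) = 1 / lam := fun k => by
    exact_mod_cast integral_norm_sq_mul_gaussian_muL (n := n) hlam k
  rw [add_zero, mul_add, mul_left_comm, g0, mul_one, Finset.mul_sum]
  congr 1
  refine Finset.sum_congr rfl fun k _ => ?_
  rw [mul_left_comm, g2, mul_one_div]

/-- The kernel exponent (λ/2) conj(z - w)(z + w) cancels every term of the Weyl exponent except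
those in ww̄, which add up to -λ|w|². Expanding conj(z_k - w_k)(z_k + w_k) in the polynomial factor
flips the sign of the |w_k|² term relative to |z_k|². -/
theorem weylIntegrand_drep [Fact (0 < lam)] {χ : AddChar (Fin m → ℝ) Circle} (hχ : Continuous χ)
    (X : LieAlg m n) (hX : ∀ w, coh lam w ∈ (drep α lam χ X).domain) (z w : Fin n → ℂ) :
    weylIntegrand (drep α lam χ X) hX z w =
      ((dchar χ X.1 + I * lam * X.2.2 + lam / 2 * (bil (cconj X.2.1) z - bil (cconj z) X.2.1) -
        lam / 2 * I * ∑ k, (α k X.1 : ℂ) * (‖z k‖ : ℂ) ^ 2) +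
      bil (fun k => lam / 2 * (conj (X.2.1 k) - I * α k X.1 * conj (z k))) w +
      bil (fun k => lam / 2 * (X.2.1 k + I * α k X.1 * z k)) (cconj w) +
      ∑ k, (lam / 2 * I * α k X.1) * (‖w k‖ : ℂ) ^ 2) * (Real.exp (-lam * nsq w) : ℝ) := by
  rw [weylIntegrand, kernel_drep hχ, mul_assoc, ← Complex.exp_add, ofReal_exp]
  congr 1
  · simp only [bil, cconj, ← Complex.conj_mul', Pi.add_apply, Pi.sub_apply, map_sub, Finset.mul_sum,
      ← Finset.sum_sub_distrib, add_sub_assoc, add_assoc, ← Finset.sum_add_distrib]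
    congr 2
    refine Finset.sum_congr rfl fun k _ => ?_
    ring
  · congr 1
    push_cast
    rw [ofReal_nsq]
    simp only [bil, cconj, Pi.add_apply, Pi.sub_apply, map_sub, Finset.mul_sum,
      ← Finset.sum_sub_distrib, ← Finset.sum_neg_distrib, ← Finset.sum_add_distrib]
    refine Finset.sum_congr rfl fun k _ => ?_
    ring

theorem weyl0_drep [Fact (0 < lam)] {χ : AddChar (Fin m → ℝ) Circle} (hχ : Continuous χ)
    (X : LieAlg m n) (hX : ∀ w, coh lam w ∈ (drep α lam χ X).domain) (z : Fin n → ℂ) :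
    Integrable (weylIntegrand (drep α lam χ X) hX z) (muL n lam) ∧
    weyl0 (drep α lam χ X) hX z =
      dchar χ X.1 + I * lam * X.2.2 + lam / 2 * (bil (cconj X.2.1) z - bil (cconj z) X.2.1) +
        1 / 2 * I * ∑ k, (α k X.1 : ℂ) * (1 - lam * (‖z k‖ : ℂ) ^ 2) := by
  have hlam : 0 < lam := Fact.out
  have hlam' : (lam : ℂ) ≠ 0 := by exact_mod_cast hlam.ne'
  rw [weyl0, funext (weylIntegrand_drep hχ X hX z)]
  refine ⟨(integral_quadratic_mul_gaussian hlam _ _ _ _).1, ?_⟩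
  -- The means of the quadratic terms are (λ/2) i α_k(t)/λ = (i/2) α_k(t); they join the -(λ/2) i
  -- α_k(t)|z_k|² of the constant term.
  rw [(integral_quadratic_mul_gaussian hlam _ _ _ _).2, sub_add]
  rw [sub_eq_add_neg, neg_sub, Finset.mul_sum, Finset.mul_sum, ← Finset.sum_sub_distrib]
  congr 1
  refine Finset.sum_congr rfl fun k _ => ?_
  field_simp

end Weyl

end GenDiamond

end

/-- The Berezin symbol and the complex Weyl symbol of `dπ(X)`, `X = (t, u, c)`, for the
representation `π` of the generalized diamond group on the Fock space given by `λ > 0` and the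
unitary character `χ`. -/
theorem mainTheorem5 (m n : ℕ) (α : Fin n → Module.Dual ℝ (Fin m → ℝ))
    (lam : ℝ) [Fact (0 < lam)] (χ : AddChar (Fin m → ℝ) Circle) (hχ : Continuous χ)
    (t : Fin m → ℝ) (u : Fin n → ℂ) (c : ℝ) :
    DifferentiableAt ℝ (fun s : Fin m → ℝ => (χ s : ℂ)) 0 ∧
    ∃ hX : ∀ w, GenDiamond.coh lam w ∈ (GenDiamond.drep α lam χ (t, u, c)).domain,
      ∀ z : Fin n → ℂ,
        GenDiamond.berezin (GenDiamond.drep α lam χ (t, u, c)) hX z =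
          GenDiamond.dchar χ t + Complex.I * lam * c +
            lam / 2 * (GenDiamond.bil (GenDiamond.cconj u) z -
              GenDiamond.bil (GenDiamond.cconj z) u) -
            lam / 2 * Complex.I *
              GenDiamond.bil (GenDiamond.cconj z) (fun k => (α k t : ℂ) * z k) ∧
        MeasureTheory.Integrable
          (GenDiamond.weylIntegrand (GenDiamond.drep α lam χ (t, u, c)) hX z)
          (GenDiamond.muL n lam) ∧
        GenDiamond.weyl0 (GenDiamond.drep α lam χ (t, u, c)) hX z =
          GenDiamond.dchar χ t + Complex.I * lam * c +
            lam / 2 * (GenDiamond.bil (GenDiamond.cconj u) z -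
              GenDiamond.bil (GenDiamond.cconj z) u) +
            1 / 2 * Complex.I * ∑ k, (α k t : ℂ) * (1 - lam * (‖z k‖ : ℂ) ^ 2) := by
  -- Membership in the domain of `drep` is by definition differentiability of the orbit map at 0.
  refine ⟨GenDiamond.differentiable_char hχ 0,
    fun w => GenDiamond.differentiableAt_rep_coh hχ (t, u, c) w, fun z => ⟨?_, ?_⟩⟩
  · exact GenDiamond.berezin_drep hχ (t, u, c) _ z
  · exact GenDiamond.weyl0_drep hχ (t, u, c) _ z
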